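/- Let $U\subset\mathbb R^2$ be open, with coordinates $x=x^1,\ y=x^2$ and $\partial_1=\partial_x,\ \partial_2=\partial_y$. Let $\Lambda=\Lambda(x,y,y')$ be a function of class $C^1$ on $U\times\mathbb R$, and let $g$ be a Riemannian or Lorentzian metric of class $C^6$ on $U$ (so that the components $\Gamma^c_{ab}$ of its Levi-Civita connection are of class $C^5$). Suppose that the integral curves of $$\frac{d^2y}{dx^2}=\Lambda\Big(x,y,\frac{dy}{dx}\Big)$$ are geodesics of the Levi-Civita connection of $g$, i.e. for every solution $y$ on an open interval with graph in $U$, the curve $\gamma(x)=(x,y(x))$ is an unparametrised geodesic: $\ddot\gamma^c+\Gamma^c_{ab}\dot\gamma^a\dot\gamma^b=v\,\dot\gamma^c$ for some function $v$. Then $\Lambda$ is at most cubic in $y'$: there are functions $A_0,\dots,A_3$ of class $C^5$ on $U$ with $$\Lambda(x,y,y')=A_3(x,y)\,y'^3+A_2(x,y)\,y'^2+A_1(x,y)\,y'+A_0(x,y)\quad\text{on } U\times\mathbb R,$$ and the projective structure $[\Gamma]$ given by these $A_\alpha$ satisfies $$\det\mathcal M([\Gamma])=0\quad\text{at every point of }U.$$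 Here $\mathcal M([\Gamma])$ is the $6\times6$ matrix with the rows ${\bf V},\ D_1{\bf V},\ D_2{\bf V},\ D_1D_1{\bf V},\ \tfrac12(D_1D_2+D_2D_1){\bf V},\ D_2D_2{\bf V}$, where $D_a{\bf W}=\partial_a{\bf W}-{\bf W}\,{\bf\Omega}_a$ for row vector fields ${\bf W}:U\to\mathbb R^6$, and ${\bf V}=(V_1,\dots,V_6)$ and the $6\times 6$ matrices ${\bf\Omega}_1,{\bf\Omega}_2$ are as follows. Put $$\begin{aligned} L_1={}&\tfrac23\partial_x\partial_yA_1-\tfrac13\partial_x^2A_2-\partial_y^2A_0+A_0\partial_yA_2+A_2\partial_yA_0-A_3\partial_xA_0-2A_0\partial_xA_3-\tfrac23A_1\partial_yA_1+\tfrac13A_1\partial_xA_2,\\ L_2={}&\tfrac23\partial_x\partial_yA_2-\tfrac13\partial_y^2A_1-\partial_x^2A_3-A_3\partial_xA_1-A_1\partial_xA_3+A_0\partial_yA_3+2A_3\partial_yA_0+\tfrac23A_2\partial_xA_2-\tfrac13A_2\partial_yA_1. \end{aligned}$$ Then $$\begin{aligned} V_1&=2\partial_yL_2+4A_2L_2+8A_3L_1,&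 V_2&=-2\partial_yL_1-2\partial_xL_2-\tfrac43A_1L_2+\tfrac43A_2L_1,\\ V_3&=2\partial_xL_1-8A_0L_2-4A_1L_1,& V_4&=-5L_2,\quad V_5=-5L_1,\quad V_6=0, \end{aligned}$$ $${\bf\Omega}_1=\begin{pmatrix}-\frac23A_1&2A_0&0&0&0&0\\0&0&0&-\frac12&0&0\\-2A_3&-\frac23A_2&\frac43A_1&0&1&0\\a_{41}&a_{42}&a_{43}&-\frac13A_1&-3A_0&0\\0&0&0&0&0&-1\\a_{61}&a_{62}&a_{63}&a_{64}&a_{65}&-\frac13A_1\end{pmatrix},\quad {\bf\Omega}_2=\begin{pmatrix}-\frac43A_2&\frac23A_1&2A_0&1&0&0\\0&0&0&0&-\frac12&0\\0&-2A_3&\frac23A_2&0&0&0\\0&0&0&0&0&-1\\b_{51}&b_{52}&b_{53}&3A_3&\frac13A_2&0\\b_{61}&b_{62}&b_{63}&b_{64}&b_{65}&\frac13A_2\end{pmatrix},$$ with $$\begin{aligned} a_{41}={}&-\tfrac43\partial_xA_2+4A_0A_3+\tfrac23\partial_yA_1,\\ a_{42}={}&-2\partial_yA_0+\tfrac23\partial_xA_1+4A_2A_0-\tfrac49A_1^2,\\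 a_{43}={}&2\partial_xA_0-4A_0A_1,\\ a_{61}={}&-\tfrac43\partial_x\partial_yA_2-\tfrac{20}3A_0A_2A_3+\tfrac23\partial_y^2A_1+4A_3\partial_yA_0-2A_0\partial_yA_3-\tfrac{16}9A_2\partial_xA_2+\tfrac89A_2\partial_yA_1,\\ a_{62}={}&\tfrac23\partial_x\partial_yA_1-\tfrac43A_1\partial_yA_1+2A_0\partial_yA_2-2\partial_y^2A_0+4A_2\partial_yA_0+4A_3\partial_xA_0+6A_0\partial_xA_3\\&+\tfrac89A_1\partial_xA_2+\tfrac43A_0A_1A_3-\tfrac43A_0A_2^2,\\ a_{63}={}&2\partial_x\partial_yA_0+\tfrac23A_0\partial_xA_2-\tfrac43A_2\partial_xA_0-4A_1\partial_yA_0-\tfrac43A_0\partial_yA_1+\tfrac83A_0A_1A_2+4A_3A_0^2,\\ a_{64}={}&\tfrac43\partial_xA_2-\partial_yA_1+5A_0A_3,\\ a_{65}={}&\tfrac13\partial_xA_1-4\partial_yA_0+3A_2A_0-\tfrac29A_1^2,\\ b_{51}={}&-2\partial_yA_3-4A_3A_2,\\ b_{52}={}&2\partial_xA_3-\tfrac23\partial_yA_2+4A_1A_3-\tfrac49A_2^2,\\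 b_{53}={}&\tfrac43\partial_yA_1-\tfrac23\partial_xA_2+4A_0A_3,\\ b_{61}={}&-2\partial_x\partial_yA_3-4A_2\partial_xA_3-\tfrac43A_3\partial_xA_2+\tfrac23A_3\partial_yA_1-\tfrac43A_1\partial_yA_3-4A_0A_3^2-\tfrac83A_1A_2A_3,\\ b_{62}={}&2\partial_x^2A_3-\tfrac43A_2\partial_xA_2-\tfrac43A_0A_2A_3-\tfrac23\partial_x\partial_yA_2+4A_1\partial_xA_3+4A_0\partial_yA_3+6A_3\partial_yA_0\\&+\tfrac43A_3A_1^2+2A_3\partial_xA_1+\tfrac89A_2\partial_yA_1,\\ b_{63}={}&-\tfrac23\partial_x^2A_2+\tfrac89A_1\partial_xA_2+4A_0\partial_xA_3-2A_3\partial_xA_0-\tfrac{16}9A_1\partial_yA_1+\tfrac43\partial_x\partial_yA_1+\tfrac{20}3A_0A_1A_3,\\ b_{64}={}&4\partial_xA_3-\tfrac13\partial_yA_2+3A_1A_3-\tfrac29A_2^2,\\ b_{65}={}&\partial_xA_2-\tfrac43\partial_yA_1+5A_0A_3. \end{aligned}$$ -/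

import Mathlib

/-- The coordinate plane; the coordinates `x = x¹` and `y = x²` have indices `0` and `1`. -/
abbrev Plane : Type := Fin 2 → ℝ

/-- The partial derivative `∂ₐ f`, so `pd 0 = ∂/∂x` and `pd 1 = ∂/∂y`. -/
noncomputable def pd (a : Fin 2) (f : Plane → ℝ) : Plane → ℝ :=
  fun q => fderiv ℝ f q (Pi.single a 1)

/-! ### Metrics, Levi-Civita connections, geodesics, integral curves -/

/-- `g` is a metric on `U`, Riemannian or Lorentzian, of class `C⁶`
(equivalently, its Christoffel symbols are of class `C⁵`). -/
structure IsMetricOn (U : Set Plane) (g : Plane → Matrix (Fin 2) (Fin 2) ℝ) : Prop where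
  symm : ∀ q ∈ U, (g q).IsSymm
  nondegenerate : ∀ q ∈ U, (g q).det ≠ 0
  contDiffOn : ∀ a b, ContDiffOn ℝ 6 (fun q => g q a b) U

/-- The symbols `Γᶜₐᵦ` (written `christoffel g c a b`) of the Levi-Civita connection of `g`. -/
noncomputable def christoffel (g : Plane → Matrix (Fin 2) (Fin 2) ℝ) (c a b : Fin 2) :
    Plane → ℝ :=
  fun q => (1 / 2) * ∑ d, (g q)⁻¹ c d *
    (pd b (fun r => g r a d) q + pd a (fun r => g r b d) q - pd d (fun r => g r a b) q)

/-- A regular curve `γ`, defined on the open set `I` of parameters, is an unparametrised geodesic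
of the connection `Γ`: `γ̈ᶜ + Γᶜₐᵦ γ̇ᵃ γ̇ᵇ = v γ̇ᶜ` for some function `v` of the parameter. -/
def IsUnparametrisedGeodesicOn (Γ : Fin 2 → Fin 2 → Fin 2 → Plane → ℝ) (I : Set ℝ)
    (γ : ℝ → Plane) : Prop :=
  ∃ v : ℝ → ℝ, ∀ t ∈ I, DifferentiableAt ℝ γ t ∧ deriv γ t ≠ 0 ∧
    HasDerivAt (deriv γ)
      (fun c => v t * deriv γ t c -
        ∑ a, ∑ b, Γ c a b (γ t) * deriv γ t a * deriv γ t b) t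

/-- On the open set `I ⊆ ℝ`, the function `y` solves `y'' = Λ(x, y, y')`,
and its graph stays in `U`. -/
def IsIntegralCurveOf (U : Set Plane) (Λ : Plane → ℝ → ℝ) (I : Set ℝ) (y : ℝ → ℝ) : Prop :=
  ∀ x ∈ I, ![x, y x] ∈ U ∧ DifferentiableAt ℝ y x ∧
    HasDerivAt (deriv y) (Λ ![x, y x] (deriv y x)) x

/-! ### The obstruction

`A = (A₀, A₁, A₂, A₃)` are the coefficients of
`y'' = A₃(x, y) y'³ + A₂(x, y) y'² + A₁(x, y) y' + A₀(x, y)`, that is, of a projective structure. -/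

section Obstruction

/-- The Liouville expression `L₁`. -/
noncomputable def liouvilleL1 (A : Fin 4 → Plane → ℝ) : Plane → ℝ := fun q =>
  2/3 * pd 0 (pd 1 (A 1)) q - 1/3 * pd 0 (pd 0 (A 2)) q - pd 1 (pd 1 (A 0)) q
  + A 0 q * pd 1 (A 2) q + A 2 q * pd 1 (A 0) q - A 3 q * pd 0 (A 0) q
  - 2 * A 0 q * pd 0 (A 3) q - 2/3 * A 1 q * pd 1 (A 1) q + 1/3 * A 1 q * pd 0 (A 2) q

/-- The Liouville expression `L₂`. -/
noncomputable def liouvilleL2 (A : Fin 4 → Plane → ℝ) : Plane → ℝ := fun q =>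
  2/3 * pd 0 (pd 1 (A 2)) q - 1/3 * pd 1 (pd 1 (A 1)) q - pd 0 (pd 0 (A 3)) q
  - A 3 q * pd 0 (A 1) q - A 1 q * pd 0 (A 3) q + A 0 q * pd 1 (A 3) q
  + 2 * A 3 q * pd 1 (A 0) q + 2/3 * A 2 q * pd 0 (A 2) q - 1/3 * A 2 q * pd 1 (A 1) q

/-- The row vector field `V`. -/
noncomputable def obstructionV (A : Fin 4 → Plane → ℝ) : Plane → Fin 6 → ℝ := fun q =>
  ![2 * pd 1 (liouvilleL2 A) q + 4 * A 2 q * liouvilleL2 A q + 8 * A 3 q * liouvilleL1 A q,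
    -2 * pd 1 (liouvilleL1 A) q - 2 * pd 0 (liouvilleL2 A) q
      - 4/3 * A 1 q * liouvilleL2 A q + 4/3 * A 2 q * liouvilleL1 A q,
    2 * pd 0 (liouvilleL1 A) q - 8 * A 0 q * liouvilleL2 A q - 4 * A 1 q * liouvilleL1 A q,
    -5 * liouvilleL2 A q,
    -5 * liouvilleL1 A q,
    0]

/-- The fourth row of `Ω₁`. -/
noncomputable def omega1Row4 (A : Fin 4 → Plane → ℝ) : Plane → Fin 6 → ℝ := fun q =>
  ![-(4/3) * pd 0 (A 2) q + 4 * A 0 q * A 3 q + 2/3 * pd 1 (A 1) q,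
    -2 * pd 1 (A 0) q + 2/3 * pd 0 (A 1) q + 4 * A 2 q * A 0 q - 4/9 * A 1 q ^ 2,
    2 * pd 0 (A 0) q - 4 * A 0 q * A 1 q,
    -(1/3) * A 1 q,
    -3 * A 0 q,
    0]

/-- The sixth row of `Ω₁`. -/
noncomputable def omega1Row6 (A : Fin 4 → Plane → ℝ) : Plane → Fin 6 → ℝ := fun q =>
  ![-(4/3) * pd 0 (pd 1 (A 2)) q - 20/3 * A 0 q * A 2 q * A 3 q + 2/3 * pd 1 (pd 1 (A 1)) q
      + 4 * A 3 q * pd 1 (A 0) q - 2 * A 0 q * pd 1 (A 3) q - 16/9 * A 2 q * pd 0 (A 2) q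
      + 8/9 * A 2 q * pd 1 (A 1) q,
    2/3 * pd 0 (pd 1 (A 1)) q - 4/3 * A 1 q * pd 1 (A 1) q + 2 * A 0 q * pd 1 (A 2) q
      - 2 * pd 1 (pd 1 (A 0)) q + 4 * A 2 q * pd 1 (A 0) q + 4 * A 3 q * pd 0 (A 0) q
      + 6 * A 0 q * pd 0 (A 3) q + 8/9 * A 1 q * pd 0 (A 2) q
      + 4/3 * A 0 q * A 1 q * A 3 q - 4/3 * A 0 q * A 2 q ^ 2,
    2 * pd 0 (pd 1 (A 0)) q + 2/3 * A 0 q * pd 0 (A 2) q - 4/3 * A 2 q * pd 0 (A 0) q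
      - 4 * A 1 q * pd 1 (A 0) q - 4/3 * A 0 q * pd 1 (A 1) q
      + 8/3 * A 0 q * A 1 q * A 2 q + 4 * A 3 q * A 0 q ^ 2,
    4/3 * pd 0 (A 2) q - pd 1 (A 1) q + 5 * A 0 q * A 3 q,
    1/3 * pd 0 (A 1) q - 4 * pd 1 (A 0) q + 3 * A 2 q * A 0 q - 2/9 * A 1 q ^ 2,
    -(1/3) * A 1 q]

/-- The fifth row of `Ω₂`. -/
noncomputable def omega2Row5 (A : Fin 4 → Plane → ℝ) : Plane → Fin 6 → ℝ := fun q =>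
  ![-2 * pd 1 (A 3) q - 4 * A 3 q * A 2 q,
    2 * pd 0 (A 3) q - 2/3 * pd 1 (A 2) q + 4 * A 1 q * A 3 q - 4/9 * A 2 q ^ 2,
    4/3 * pd 1 (A 1) q - 2/3 * pd 0 (A 2) q + 4 * A 0 q * A 3 q,
    3 * A 3 q,
    1/3 * A 2 q,
    0]

/-- The sixth row of `Ω₂`. -/
noncomputable def omega2Row6 (A : Fin 4 → Plane → ℝ) : Plane → Fin 6 → ℝ := fun q =>
  ![-2 * pd 0 (pd 1 (A 3)) q - 4 * A 2 q * pd 0 (A 3) q - 4/3 * A 3 q * pd 0 (A 2) q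
      + 2/3 * A 3 q * pd 1 (A 1) q - 4/3 * A 1 q * pd 1 (A 3) q
      - 4 * A 0 q * A 3 q ^ 2 - 8/3 * A 1 q * A 2 q * A 3 q,
    2 * pd 0 (pd 0 (A 3)) q - 4/3 * A 2 q * pd 0 (A 2) q - 4/3 * A 0 q * A 2 q * A 3 q
      - 2/3 * pd 0 (pd 1 (A 2)) q + 4 * A 1 q * pd 0 (A 3) q + 4 * A 0 q * pd 1 (A 3) q
      + 6 * A 3 q * pd 1 (A 0) q + 4/3 * A 3 q * A 1 q ^ 2 + 2 * A 3 q * pd 0 (A 1) q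
      + 8/9 * A 2 q * pd 1 (A 1) q,
    -(2/3) * pd 0 (pd 0 (A 2)) q + 8/9 * A 1 q * pd 0 (A 2) q + 4 * A 0 q * pd 0 (A 3) q
      - 2 * A 3 q * pd 0 (A 0) q - 16/9 * A 1 q * pd 1 (A 1) q
      + 4/3 * pd 0 (pd 1 (A 1)) q + 20/3 * A 0 q * A 1 q * A 3 q,
    4 * pd 0 (A 3) q - 1/3 * pd 1 (A 2) q + 3 * A 1 q * A 3 q - 2/9 * A 2 q ^ 2,
    pd 0 (A 2) q - 4/3 * pd 1 (A 1) q + 5 * A 0 q * A 3 q,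
    1/3 * A 2 q]

/-- The connection matrix `Ω₁`. -/
noncomputable def omega1 (A : Fin 4 → Plane → ℝ) : Plane → Matrix (Fin 6) (Fin 6) ℝ := fun q =>
  Matrix.of ![
    ![-(2/3) * A 1 q, 2 * A 0 q, 0, 0, 0, 0],
    ![0, 0, 0, -(1/2), 0, 0],
    ![-2 * A 3 q, -(2/3) * A 2 q, 4/3 * A 1 q, 0, 1, 0],
    omega1Row4 A q,
    ![0, 0, 0, 0, 0, -1],
    omega1Row6 A q]

/-- The connection matrix `Ω₂`. -/
noncomputable def omega2 (A : Fin 4 → Plane → ℝ) : Plane → Matrix (Fin 6) (Fin 6) ℝ := fun q =>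
  Matrix.of ![
    ![-(4/3) * A 2 q, 2/3 * A 1 q, 2 * A 0 q, 1, 0, 0],
    ![0, 0, 0, 0, -(1/2), 0],
    ![0, -2 * A 3 q, 2/3 * A 2 q, 0, 0, 0],
    ![0, 0, 0, 0, 0, -1],
    omega2Row5 A q,
    omega2Row6 A q]

/-- `Ωₐ`, with `a = 0, 1` for `x, y`. -/
noncomputable def omega (A : Fin 4 → Plane → ℝ) (a : Fin 2) :
    Plane → Matrix (Fin 6) (Fin 6) ℝ :=
  ![omega1 A, omega2 A] a

/-- `Dₐ W = ∂ₐ W - W Ωₐ` for a row vector field `W`. -/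
noncomputable def covD (A : Fin 4 → Plane → ℝ) (a : Fin 2) (W : Plane → Fin 6 → ℝ) :
    Plane → Fin 6 → ℝ :=
  fun q j => pd a (fun r => W r j) q - Matrix.vecMul (W q) (omega A a q) j

/-- The 6 by 6 matrix with the rows `V, Dₐ V, D₍ᵦ Dₐ₎ V`. -/
noncomputable def obstructionMatrix (A : Fin 4 → Plane → ℝ) :
    Plane → Matrix (Fin 6) (Fin 6) ℝ := fun q =>
  Matrix.of ![
    obstructionV A q,
    covD A 0 (obstructionV A) q,
    covD A 1 (obstructionV A) q,
    covD A 0 (covD A 0 (obstructionV A)) q,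
    (1 / 2 : ℝ) • (covD A 0 (covD A 1 (obstructionV A)) q
      + covD A 1 (covD A 0 (obstructionV A)) q),
    covD A 1 (covD A 1 (obstructionV A)) q]

end Obstruction

/-! The determinant vanishes because the metric supplies a nonzero vector in the kernel of the
obstruction matrix.

The components of `g`, rescaled by `|det g|^(-2/3)`, satisfy a linear first order system whose
coefficients are only the projective combinations of the Christoffel symbols
(`IsMetricOn.isLiouvilleSolution`). It prescribes four combinations of the six first derivatives of
the three unknowns. Adjoining the two missing first derivatives and one second derivative closes it:
equality of mixed partials determines every other derivative, so the extended vector `Ψ` satisfies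
`∂ₐΨ = -Ωₐ Ψ` (`IsLiouvilleSolution.pd_prolong`).

One integrability condition remains, the equality of the mixed derivatives of the last component of
`Ψ`. It is algebraic: `V · Ψ = 0` (`IsLiouvilleSolution.obstructionV_dotProduct`). Differentiating
it along the connection gives `DₐV · Ψ = 0` and `DᵦDₐV · Ψ = 0` (`covD_dotProduct_eq_zero`), so all
six rows annihilate `Ψ`, which is nonzero because `g` is nondegenerate.

That `Λ` is cubic is separate: through each point, in each nonvertical direction, passes an integral
curve, and eliminating `v` from its two geodesic equations leaves a cubic in the slope. -/

/-! ### Calculus of the partial derivatives -/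

section Calculus

variable {U : Set Plane} {f g : Plane → ℝ} {q : Plane} {a : Fin 2}

theorem pd_congr (hU : IsOpen U) (hq : q ∈ U) (h : ∀ r ∈ U, f r = g r) (a : Fin 2) :
    pd a f q = pd a g q := by
  have : f =ᶠ[nhds q] g := Filter.eventually_of_mem (hU.mem_nhds hq) h
  simp only [pd, this.fderiv_eq]

theorem pd_const (c : ℝ) : pd a (fun _ => c) q = 0 := by
  simp [pd]

theorem pd_add (hf : DifferentiableAt ℝ f q) (hg : DifferentiableAt ℝ g q) :
    pd a (fun r => f r + g r) q = pd a f q + pd a g q := by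
  simp [pd, fderiv_fun_add hf hg]

theorem pd_sub (hf : DifferentiableAt ℝ f q) (hg : DifferentiableAt ℝ g q) :
    pd a (fun r => f r - g r) q = pd a f q - pd a g q := by
  simp [pd, fderiv_fun_sub hf hg]

theorem pd_mul (hf : DifferentiableAt ℝ f q) (hg : DifferentiableAt ℝ g q) :
    pd a (fun r => f r * g r) q = f q * pd a g q + pd a f q * g q := by
  simp [pd, fderiv_fun_mul hf hg]; ring

theorem pd_const_mul (c : ℝ) (hf : DifferentiableAt ℝ f q) :
    pd a (fun r => c * f r) q = c * pd a f q := by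
  simp [pd, fderiv_const_mul hf]

theorem pd_pow (n : ℕ) (hf : DifferentiableAt ℝ f q) :
    pd a (fun r => f r ^ n) q = n * f q ^ (n - 1) * pd a f q := by
  simp [pd, fderiv_fun_pow n hf]

theorem pd_sum {ι : Type*} (s : Finset ι) {F : ι → Plane → ℝ}
    (hF : ∀ i ∈ s, DifferentiableAt ℝ (F i) q) :
    pd a (fun r => ∑ i ∈ s, F i r) q = ∑ i ∈ s, pd a (F i) q := by
  simp [pd, fderiv_fun_sum hF]

theorem pd_comp {φ : ℝ → ℝ} {φ' : ℝ} (hφ : HasDerivAt φ φ' (f q)) (hf : DifferentiableAt ℝ f q) :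
    pd a (fun r => φ (f r)) q = φ' * pd a f q := by
  have h := (hφ.comp_hasFDerivAt q hf.hasFDerivAt).fderiv
  simp only [Function.comp_def] at h
  simp [pd, h]

theorem ContDiffOn.pd {m n : WithTop ℕ∞} (hf : ContDiffOn ℝ n f U) (hU : IsOpen U)
    (hmn : m + 1 ≤ n) (a : Fin 2) : ContDiffOn ℝ m (pd a f) U :=
  (hf.fderiv_of_isOpen hU hmn).clm_apply contDiffOn_const

theorem ContDiffOn.differentiableAt_of_isOpen {n : WithTop ℕ∞} (hf : ContDiffOn ℝ n f U)
    (hU : IsOpen U) (hn : n ≠ 0) (hq : q ∈ U) : DifferentiableAt ℝ f q :=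
  (hf.contDiffAt (hU.mem_nhds hq)).differentiableAt hn

theorem pd_comm (hf : ContDiffOn ℝ 2 f U) (hU : IsOpen U) (hq : q ∈ U) :
    pd 1 (pd 0 f) q = pd 0 (pd 1 f) q := by
  have hs : IsSymmSndFDerivAt ℝ f q :=
    (hf.contDiffAt (hU.mem_nhds hq)).isSymmSndFDerivAt (by simp)
  have hd : DifferentiableAt ℝ (fderiv ℝ f) q :=
    ((hf.fderiv_of_isOpen hU (m := 1) (by norm_num)).contDiffAt
      (hU.mem_nhds hq)).differentiableAt (by simp)
  have key : ∀ a b : Fin 2, pd a (pd b f) q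
      = fderiv ℝ (fderiv ℝ f) q (Pi.single a 1) (Pi.single b 1) := by
    intro a b
    have h : pd b f = fun r => fderiv ℝ f r (Pi.single b 1) := rfl
    rw [pd, h, fderiv_clm_apply hd (by fun_prop)]
    simp
  rw [key, key]
  exact hs _ _

end Calculus

/-! ### The linear system for metrics with prescribed geodesics, and its prolongation -/

section Prolongation

/-- The linear first order system for the rescaled components `ψ = (E, F, G) / Δ^(2/3)` of a metric
`E dx² + 2 F dx dy + G dy²` whose geodesics are the curves of the projective structure `A`. -/
structure IsLiouvilleSolution (U : Set Plane) (A : Fin 4 → Plane → ℝ) (ψ : Fin 3 → Plane → ℝ) :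
    Prop where
  pd_zero_zero : ∀ q ∈ U, pd 0 (ψ 0) q = 2/3 * A 1 q * ψ 0 q - 2 * A 0 q * ψ 1 q
  pd_one_two : ∀ q ∈ U, pd 1 (ψ 2) q = 2 * A 3 q * ψ 1 q - 2/3 * A 2 q * ψ 2 q
  pd_one_zero : ∀ q ∈ U, pd 1 (ψ 0) q =
    4/3 * A 2 q * ψ 0 q - 2/3 * A 1 q * ψ 1 q - 2 * A 0 q * ψ 2 q - 2 * pd 0 (ψ 1) q
  pd_zero_two : ∀ q ∈ U, pd 0 (ψ 2) q =
    2 * A 3 q * ψ 0 q - 4/3 * A 1 q * ψ 2 q + 2/3 * A 2 q * ψ 1 q - 2 * pd 1 (ψ 1) q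

/-- The prolonged unknown: `ψ` with the undetermined first derivatives and one second derivative. -/
noncomputable def prolong (ψ : Fin 3 → Plane → ℝ) : Plane → Fin 6 → ℝ := fun q =>
  ![ψ 0 q, ψ 1 q, ψ 2 q, 2 * pd 0 (ψ 1) q, 2 * pd 1 (ψ 1) q, 2 * pd 0 (pd 1 (ψ 1)) q]

variable {U : Set Plane} {A : Fin 4 → Plane → ℝ} {ψ : Fin 3 → Plane → ℝ} {q : Plane}

/-- The mixed partials of `ψ 0` agree, and in that identity the only second derivative is `∂ₓ²ψ₁`,
coming from the term `-2 ∂ₓψ₁` of `∂ᵧψ₀`; it can be solved for. -/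
theorem IsLiouvilleSolution.pd_zero_pd_zero (h : IsLiouvilleSolution U A ψ) (hU : IsOpen U)
    (hA : ∀ i, ContDiffOn ℝ 5 (A i) U) (hψ : ∀ i, ContDiffOn ℝ 6 (ψ i) U) (hq : q ∈ U) :
    pd 0 (pd 0 (ψ 1)) q = -(1/2) * (omega1Row4 A q 0 * ψ 0 q + omega1Row4 A q 1 * ψ 1 q
      + omega1Row4 A q 2 * ψ 2 q + omega1Row4 A q 3 * (2 * pd 0 (ψ 1) q)
      + omega1Row4 A q 4 * (2 * pd 1 (ψ 1) q)) := by
  have dA : ∀ i, DifferentiableAt ℝ (A i) q := fun i =>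
    (hA i).differentiableAt_of_isOpen hU (by norm_num) hq
  have dψ : ∀ i, DifferentiableAt ℝ (ψ i) q := fun i =>
    (hψ i).differentiableAt_of_isOpen hU (by norm_num) hq
  have dψ' : ∀ i a, DifferentiableAt ℝ (pd a (ψ i)) q := fun i a =>
    ((hψ i).pd hU (m := 5) (by norm_num) a).differentiableAt_of_isOpen hU (by norm_num) hq
  have key := pd_comm ((hψ 0).of_le (by norm_num)) hU hq
  rw [pd_congr hU hq h.pd_zero_zero, pd_congr hU hq h.pd_one_zero] at key
  simp (disch := fun_prop) only [pd_sub, pd_mul, pd_const] at key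
  rw [h.pd_one_zero q hq, h.pd_zero_zero q hq, h.pd_zero_two q hq] at key
  simp only [omega1Row4, Matrix.cons_val]
  linear_combination (1/2) * key

/-- The mirror image, from the mixed partials of `ψ 2`. -/
theorem IsLiouvilleSolution.pd_one_pd_one (h : IsLiouvilleSolution U A ψ) (hU : IsOpen U)
    (hA : ∀ i, ContDiffOn ℝ 5 (A i) U) (hψ : ∀ i, ContDiffOn ℝ 6 (ψ i) U) (hq : q ∈ U) :
    pd 1 (pd 1 (ψ 1)) q = -(1/2) * (omega2Row5 A q 0 * ψ 0 q + omega2Row5 A q 1 * ψ 1 q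
      + omega2Row5 A q 2 * ψ 2 q + omega2Row5 A q 3 * (2 * pd 0 (ψ 1) q)
      + omega2Row5 A q 4 * (2 * pd 1 (ψ 1) q)) := by
  have dA : ∀ i, DifferentiableAt ℝ (A i) q := fun i =>
    (hA i).differentiableAt_of_isOpen hU (by norm_num) hq
  have dψ : ∀ i, DifferentiableAt ℝ (ψ i) q := fun i =>
    (hψ i).differentiableAt_of_isOpen hU (by norm_num) hq
  have dψ' : ∀ i a, DifferentiableAt ℝ (pd a (ψ i)) q := fun i a =>
    ((hψ i).pd hU (m := 5) (by norm_num) a).differentiableAt_of_isOpen hU (by norm_num) hq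
  have key := pd_comm ((hψ 2).of_le (by norm_num)) hU hq
  rw [pd_congr hU hq h.pd_zero_two, pd_congr hU hq h.pd_one_two] at key
  simp (disch := fun_prop) only [pd_add, pd_sub, pd_mul, pd_const] at key
  rw [h.pd_one_zero q hq, h.pd_one_two q hq, h.pd_zero_two q hq] at key
  simp only [omega2Row5, Matrix.cons_val]
  linear_combination (-1/2) * key

/-- Reordered as `∂ᵧ(∂ₓ²ψ₁)`, this is the `y`-derivative of a known expression; the `∂ᵧ²ψ₁` it
produces is eliminated by `pd_one_pd_one`. -/
theorem IsLiouvilleSolution.pd_zero_pd_zero_pd_one (h : IsLiouvilleSolution U A ψ) (hU : IsOpen U)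
    (hA : ∀ i, ContDiffOn ℝ 5 (A i) U) (hψ : ∀ i, ContDiffOn ℝ 6 (ψ i) U) (hq : q ∈ U) :
    pd 0 (pd 0 (pd 1 (ψ 1))) q = -(1/2) * (omega1Row6 A q 0 * ψ 0 q + omega1Row6 A q 1 * ψ 1 q
      + omega1Row6 A q 2 * ψ 2 q + omega1Row6 A q 3 * (2 * pd 0 (ψ 1) q)
      + omega1Row6 A q 4 * (2 * pd 1 (ψ 1) q)
      + omega1Row6 A q 5 * (2 * pd 0 (pd 1 (ψ 1)) q)) := by
  have dA : ∀ i, DifferentiableAt ℝ (A i) q := fun i =>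
    (hA i).differentiableAt_of_isOpen hU (by norm_num) hq
  have dA' : ∀ i a, DifferentiableAt ℝ (pd a (A i)) q := fun i a =>
    ((hA i).pd hU (m := 4) (by norm_num) a).differentiableAt_of_isOpen hU (by norm_num) hq
  have dψ : ∀ i, DifferentiableAt ℝ (ψ i) q := fun i =>
    (hψ i).differentiableAt_of_isOpen hU (by norm_num) hq
  have dψ' : ∀ i a, DifferentiableAt ℝ (pd a (ψ i)) q := fun i a =>
    ((hψ i).pd hU (m := 5) (by norm_num) a).differentiableAt_of_isOpen hU (by norm_num) hq
  have hc : ∀ r ∈ U, pd 1 (pd 0 (ψ 1)) r = pd 0 (pd 1 (ψ 1)) r := fun r hr =>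
    pd_comm ((hψ 1).of_le (by norm_num)) hU hr
  have hcA : ∀ i, pd 1 (pd 0 (A i)) q = pd 0 (pd 1 (A i)) q := fun i =>
    pd_comm ((hA i).of_le (by norm_num)) hU hq
  rw [← pd_congr hU hq hc, ← pd_comm ((hψ 1).pd hU (m := 2) (by norm_num) 0) hU hq,
    pd_congr hU hq (fun r hr => h.pd_zero_pd_zero hU hA hψ hr)]
  simp only [omega1Row4, Matrix.cons_val]
  simp (disch := fun_prop) only [pd_add, pd_sub, pd_mul, pd_const, pd_pow]
  rw [h.pd_one_pd_one hU hA hψ hq, hc q hq, h.pd_one_zero q hq, h.pd_one_two q hq]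
  simp only [hcA, omega1Row6, omega2Row5, Matrix.cons_val]
  push_cast
  ring

/-- Likewise via `∂ₓ(∂ᵧ²ψ₁)`, with `∂ₓ²ψ₁` eliminated by `pd_zero_pd_zero`. -/
theorem IsLiouvilleSolution.pd_one_pd_zero_pd_one (h : IsLiouvilleSolution U A ψ) (hU : IsOpen U)
    (hA : ∀ i, ContDiffOn ℝ 5 (A i) U) (hψ : ∀ i, ContDiffOn ℝ 6 (ψ i) U) (hq : q ∈ U) :
    pd 1 (pd 0 (pd 1 (ψ 1))) q = -(1/2) * (omega2Row6 A q 0 * ψ 0 q + omega2Row6 A q 1 * ψ 1 q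
      + omega2Row6 A q 2 * ψ 2 q + omega2Row6 A q 3 * (2 * pd 0 (ψ 1) q)
      + omega2Row6 A q 4 * (2 * pd 1 (ψ 1) q)
      + omega2Row6 A q 5 * (2 * pd 0 (pd 1 (ψ 1)) q)) := by
  have dA : ∀ i, DifferentiableAt ℝ (A i) q := fun i =>
    (hA i).differentiableAt_of_isOpen hU (by norm_num) hq
  have dA' : ∀ i a, DifferentiableAt ℝ (pd a (A i)) q := fun i a =>
    ((hA i).pd hU (m := 4) (by norm_num) a).differentiableAt_of_isOpen hU (by norm_num) hq
  have dψ : ∀ i, DifferentiableAt ℝ (ψ i) q := fun i =>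
    (hψ i).differentiableAt_of_isOpen hU (by norm_num) hq
  have dψ' : ∀ i a, DifferentiableAt ℝ (pd a (ψ i)) q := fun i a =>
    ((hψ i).pd hU (m := 5) (by norm_num) a).differentiableAt_of_isOpen hU (by norm_num) hq
  rw [pd_comm ((hψ 1).pd hU (m := 2) (by norm_num) 1) hU hq,
    pd_congr hU hq (fun r hr => h.pd_one_pd_one hU hA hψ hr)]
  simp only [omega2Row5, Matrix.cons_val]
  simp (disch := fun_prop) only [pd_add, pd_sub, pd_mul, pd_const, pd_pow]
  rw [h.pd_zero_pd_zero hU hA hψ hq, h.pd_zero_zero q hq, h.pd_zero_two q hq]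
  simp only [omega2Row6, omega1Row4, Matrix.cons_val]
  push_cast
  ring

/-- The prolonged solution is parallel. -/
theorem IsLiouvilleSolution.pd_prolong (h : IsLiouvilleSolution U A ψ) (hU : IsOpen U)
    (hA : ∀ i, ContDiffOn ℝ 5 (A i) U) (hψ : ∀ i, ContDiffOn ℝ 6 (ψ i) U) (hq : q ∈ U)
    (a : Fin 2) (i : Fin 6) :
    pd a (fun r => prolong ψ r i) q = -(omega A a q).mulVec (prolong ψ q) i := by
  have dψ' : ∀ a, DifferentiableAt ℝ (pd a (ψ 1)) q := fun a =>
    ((hψ 1).pd hU (m := 5) (by norm_num) a).differentiableAt_of_isOpen hU (by norm_num) hq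
  have dψ'' : DifferentiableAt ℝ (pd 0 (pd 1 (ψ 1))) q :=
    (((hψ 1).pd hU (m := 5) (by norm_num) 1).pd hU (m := 4)
      (by norm_num) 0).differentiableAt_of_isOpen hU (by norm_num) hq
  have hc := pd_comm ((hψ 1).of_le (by norm_num)) hU hq
  have e0 : omega A 0 q = omega1 A q := rfl
  have e1 : omega A 1 q = omega2 A q := rfl
  -- The second derivative formulas have five terms; these vanishing entries match them with the
  -- six-term products.
  have z1 : omega1Row4 A q 5 = 0 := rfl
  have z2 : omega2Row5 A q 5 = 0 := rfl
  fin_cases a <;> fin_cases i <;>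
    simp only [Fin.zero_eta, Fin.mk_one, Fin.reduceFinMk, e0, e1, Matrix.mulVec, dotProduct,
      Fin.sum_univ_six, omega1, omega2, prolong, Matrix.of_apply, Matrix.cons_val] <;>
    (try rw [pd_const_mul _ (by fun_prop)])
  · rw [h.pd_zero_zero q hq]; ring
  · ring
  · rw [h.pd_zero_two q hq]; ring
  · rw [h.pd_zero_pd_zero hU hA hψ hq, z1]; ring
  · ring
  · rw [h.pd_zero_pd_zero_pd_one hU hA hψ hq]; ring
  · rw [h.pd_one_zero q hq]; ring
  · ring
  · rw [h.pd_one_two q hq]; ring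
  · rw [hc]; ring
  · rw [h.pd_one_pd_one hU hA hψ hq, z2]; ring
  · rw [h.pd_one_pd_zero_pd_one hU hA hψ hq]; ring

end Prolongation

/-! ### The integrability condition and its covariant derivatives -/

section Obstruction

variable {U : Set Plane} {A : Fin 4 → Plane → ℝ} {ψ : Fin 3 → Plane → ℝ} {q : Plane}

theorem contDiffOn_prolong (hU : IsOpen U) (hψ : ∀ i, ContDiffOn ℝ 6 (ψ i) U) (i : Fin 6) :
    ContDiffOn ℝ 4 (fun q => prolong ψ q i) U := by
  have h1 : ∀ a, ContDiffOn ℝ 5 (pd a (ψ 1)) U := fun a => (hψ 1).pd hU (by norm_num) a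
  have h2 : ContDiffOn ℝ 4 (pd 0 (pd 1 (ψ 1))) U := (h1 1).pd hU (by norm_num) 0
  have h0 : ∀ i, ContDiffOn ℝ 4 (ψ i) U := fun i => (hψ i).of_le (by norm_num)
  have h1' : ∀ a, ContDiffOn ℝ 4 (pd a (ψ 1)) U := fun a => (h1 a).of_le (by norm_num)
  fin_cases i
  · exact h0 0
  · exact h0 1
  · exact h0 2
  · exact contDiffOn_const.mul (h1' 0)
  · exact contDiffOn_const.mul (h1' 1)
  · exact contDiffOn_const.mul h2

theorem ContDiffOn.pd_pd {f : Plane → ℝ} (hf : ContDiffOn ℝ 5 f U) (hU : IsOpen U)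
    (a b : Fin 2) : ContDiffOn ℝ 3 (_root_.pd a (_root_.pd b f)) U :=
  (hf.pd hU (m := 4) (by norm_num) b).pd hU (by norm_num) a

/-- `V` involves third derivatives of the `A i`, so class `C⁵` leaves `C²`, enough for two covariant
derivatives. -/
theorem contDiffOn_obstructionV (hU : IsOpen U) (hA : ∀ i, ContDiffOn ℝ 5 (A i) U) (i : Fin 6) :
    ContDiffOn ℝ 2 (fun q => obstructionV A q i) U := by
  have h0 : ∀ i, ContDiffOn ℝ 3 (A i) U := fun i => (hA i).of_le (by norm_num)
  have h1 : ∀ i a, ContDiffOn ℝ 3 (pd a (A i)) U := fun i a =>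
    ((hA i).pd hU (m := 4) (by norm_num) a).of_le (by norm_num)
  have h2 : ∀ i a b, ContDiffOn ℝ 3 (pd a (pd b (A i))) U := fun i a b => (hA i).pd_pd hU a b
  have hL1 : ContDiffOn ℝ 3 (liouvilleL1 A) U := by
    unfold liouvilleL1
    fun_prop
  have hL2 : ContDiffOn ℝ 3 (liouvilleL2 A) U := by
    unfold liouvilleL2
    fun_prop
  have h0' : ∀ i, ContDiffOn ℝ 2 (A i) U := fun i => (hA i).of_le (by norm_num)
  have hL1' : ContDiffOn ℝ 2 (liouvilleL1 A) U := hL1.of_le (by norm_num)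
  have hL2' : ContDiffOn ℝ 2 (liouvilleL2 A) U := hL2.of_le (by norm_num)
  have dL1 : ∀ a, ContDiffOn ℝ 2 (pd a (liouvilleL1 A)) U := fun a => hL1.pd hU (by norm_num) a
  have dL2 : ∀ a, ContDiffOn ℝ 2 (pd a (liouvilleL2 A)) U := fun a => hL2.pd hU (by norm_num) a
  fin_cases i <;> simp only [obstructionV, Fin.zero_eta, Fin.mk_one, Fin.reduceFinMk,
    Matrix.cons_val] <;> fun_prop

theorem contDiffOn_omega (hU : IsOpen U) (hA : ∀ i, ContDiffOn ℝ 5 (A i) U) (a : Fin 2)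
    (i j : Fin 6) : ContDiffOn ℝ 3 (fun q => omega A a q i j) U := by
  have h0 : ∀ i, ContDiffOn ℝ 3 (A i) U := fun i => (hA i).of_le (by norm_num)
  have h1 : ∀ i a, ContDiffOn ℝ 3 (pd a (A i)) U := fun i a =>
    ((hA i).pd hU (m := 4) (by norm_num) a).of_le (by norm_num)
  have h2 : ∀ i a b, ContDiffOn ℝ 3 (pd a (pd b (A i))) U := fun i a b => (hA i).pd_pd hU a b
  have e0 : omega A 0 = omega1 A := rfl
  have e1 : omega A 1 = omega2 A := rfl
  fin_cases a <;> fin_cases i <;> fin_cases j <;>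
    simp only [Fin.zero_eta, Fin.mk_one, Fin.reduceFinMk, e0, e1, omega1, omega2, omega1Row4,
      omega1Row6, omega2Row5, omega2Row6, Matrix.of_apply, Matrix.cons_val] <;> fun_prop

/-- The bound `m ≤ 3` is the regularity of `Ωₐ`, which contains second derivatives of the `A i`. -/
theorem contDiffOn_covD {m n : WithTop ℕ∞} (hU : IsOpen U) (hA : ∀ i, ContDiffOn ℝ 5 (A i) U)
    {W : Plane → Fin 6 → ℝ} (hW : ∀ j, ContDiffOn ℝ n (fun q => W q j) U) (hmn : m + 1 ≤ n)
    (hm : m ≤ 3) (a : Fin 2) (j : Fin 6) : ContDiffOn ℝ m (fun q => covD A a W q j) U := by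
  refine ((hW j).pd hU hmn a).sub ?_
  change ContDiffOn ℝ m (fun q => ∑ i, W q i * omega A a q i j) U
  refine ContDiffOn.sum fun i _ => ?_
  exact ((hW i).of_le (le_self_add.trans hmn)).mul ((contDiffOn_omega hU hA a i j).of_le hm)

/-- The covariant derivatives of a row vector field annihilating a parallel section annihilate
it as well. -/
theorem covD_dotProduct_eq_zero (hU : IsOpen U) {W Ψ : Plane → Fin 6 → ℝ} (a : Fin 2)
    (hW : ∀ j, ∀ q ∈ U, DifferentiableAt ℝ (fun r => W r j) q)
    (hΨ : ∀ j, ∀ q ∈ U, DifferentiableAt ℝ (fun r => Ψ r j) q)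
    (hpar : ∀ q ∈ U, ∀ i, pd a (fun r => Ψ r i) q = -(omega A a q).mulVec (Ψ q) i)
    (h : ∀ q ∈ U, W q ⬝ᵥ Ψ q = 0) : ∀ q ∈ U, covD A a W q ⬝ᵥ Ψ q = 0 := by
  intro q hq
  -- Differentiate the vanishing pairing: `0 = ∂ₐW · Ψ - W · ΩₐΨ = (∂ₐW - W Ωₐ) · Ψ`.
  have key : pd a (fun r => ∑ j, W r j * Ψ r j) q = 0 := by
    exact (pd_congr hU hq h a).trans (pd_const 0)
  rw [pd_sum _ fun j _ => (hW j q hq).fun_mul (hΨ j q hq)] at key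
  simp only [fun j => pd_mul (a := a) (hW j q hq) (hΨ j q hq), hpar q hq,
    Finset.sum_add_distrib, mul_neg, Finset.sum_neg_distrib] at key
  have e : covD A a W q = (fun j => pd a (fun r => W r j) q) - Matrix.vecMul (W q) (omega A a q) :=
    rfl
  rw [e, sub_dotProduct, ← Matrix.dotProduct_mulVec]
  simp only [dotProduct]
  linarith

/-- The sixth row of the curvature of the prolongation connection is `-V`; so `V` annihilates the
prolonged solutions. -/
theorem IsLiouvilleSolution.obstructionV_dotProduct (h : IsLiouvilleSolution U A ψ)
    (hU : IsOpen U) (hA : ∀ i, ContDiffOn ℝ 5 (A i) U) (hψ : ∀ i, ContDiffOn ℝ 6 (ψ i) U)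
    (hq : q ∈ U) : obstructionV A q ⬝ᵥ prolong ψ q = 0 := by
  have dA : ∀ i, DifferentiableAt ℝ (A i) q := fun i =>
    (hA i).differentiableAt_of_isOpen hU (by norm_num) hq
  have dA' : ∀ i a, DifferentiableAt ℝ (pd a (A i)) q := fun i a =>
    ((hA i).pd hU (m := 4) (by norm_num) a).differentiableAt_of_isOpen hU (by norm_num) hq
  have dA'' : ∀ i a b, DifferentiableAt ℝ (pd a (pd b (A i))) q := fun i a b =>
    ((hA i).pd_pd hU a b).differentiableAt_of_isOpen hU (by norm_num) hq
  have dψ : ∀ i, DifferentiableAt ℝ (ψ i) q := fun i =>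
    (hψ i).differentiableAt_of_isOpen hU (by norm_num) hq
  have dψ' : ∀ i a, DifferentiableAt ℝ (pd a (ψ i)) q := fun i a =>
    ((hψ i).pd hU (m := 5) (by norm_num) a).differentiableAt_of_isOpen hU (by norm_num) hq
  have dψ'' : ∀ i a b, DifferentiableAt ℝ (pd a (pd b (ψ i))) q := fun i a b =>
    (((hψ i).pd hU (m := 5) (by norm_num) b).pd hU (m := 4)
      (by norm_num) a).differentiableAt_of_isOpen hU (by norm_num) hq
  -- These identities bring all derivatives of the `A i` to one order, `x`-derivatives outermost, so
  -- that `ring` can compare them.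
  have hcA : ∀ i, ∀ r ∈ U, pd 1 (pd 0 (A i)) r = pd 0 (pd 1 (A i)) r := fun i r hr =>
    pd_comm ((hA i).of_le (by norm_num)) hU hr
  have c1 : ∀ i, pd 1 (pd 0 (A i)) q = pd 0 (pd 1 (A i)) q := fun i => hcA i q hq
  have c2 : ∀ i a, pd 1 (pd 0 (pd a (A i))) q = pd 0 (pd 1 (pd a (A i))) q := fun i a =>
    pd_comm ((hA i).pd hU (by norm_num) a) hU hq
  have c3 : ∀ i, pd 0 (pd 1 (pd 0 (A i))) q = pd 0 (pd 0 (pd 1 (A i))) q := fun i =>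
    pd_congr hU hq (hcA i) 0
  have hcψ : pd 1 (pd 0 (ψ 1)) q = pd 0 (pd 1 (ψ 1)) q :=
    pd_comm ((hψ 1).of_le (by norm_num)) hU hq
  -- Both first derivatives of `∂ₓ∂ᵧψ₁` are now prescribed. Once the derivatives of `ψ` are
  -- substituted, the equality of its mixed derivatives is a linear relation among the six
  -- components of the prolongation.
  have key := pd_comm (f := pd 0 (pd 1 (ψ 1)))
    (((hψ 1).pd hU (m := 5) (by norm_num) 1).pd hU (by norm_num) 0) hU hq
  rw [pd_congr hU hq (fun r hr => h.pd_zero_pd_zero_pd_one hU hA hψ hr),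
    pd_congr hU hq (fun r hr => h.pd_one_pd_zero_pd_one hU hA hψ hr)] at key
  simp only [omega1Row6, omega2Row6, Matrix.cons_val] at key
  simp (disch := fun_prop) only [pd_add, pd_sub, pd_mul, pd_const, pd_pow] at key
  rw [h.pd_one_pd_zero_pd_one hU hA hψ hq, h.pd_zero_pd_zero_pd_one hU hA hψ hq,
    h.pd_zero_pd_zero hU hA hψ hq, h.pd_one_pd_one hU hA hψ hq, hcψ, h.pd_zero_zero q hq,
    h.pd_one_zero q hq, h.pd_zero_two q hq, h.pd_one_two q hq] at key
  simp only [c1, c2, omega1Row4, omega1Row6, omega2Row5, omega2Row6, Matrix.cons_val] at key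
  simp only [dotProduct, Fin.sum_univ_six, obstructionV, prolong, Matrix.cons_val]
  unfold liouvilleL1 liouvilleL2
  simp (disch := fun_prop) only [pd_add, pd_sub, pd_mul, pd_const]
  simp only [c1, c2, c3]
  push_cast at key
  -- The 2 undoes the factor `-(1/2)` in the third derivative formulas, up to sign.
  linear_combination (2 : ℝ) * key

theorem det_obstructionMatrix_eq_zero (hU : IsOpen U) (h : IsLiouvilleSolution U A ψ)
    (hA : ∀ i, ContDiffOn ℝ 5 (A i) U) (hψ : ∀ i, ContDiffOn ℝ 6 (ψ i) U) (hq : q ∈ U)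
    (hne : ∃ i, ψ i q ≠ 0) : (obstructionMatrix A q).det = 0 := by
  have hpar : ∀ a, ∀ q ∈ U, ∀ i,
      pd a (fun r => prolong ψ r i) q = -(omega A a q).mulVec (prolong ψ q) i :=
    fun a q hq i => h.pd_prolong hU hA hψ hq a i
  have hΨ : ∀ j, ∀ q ∈ U, DifferentiableAt ℝ (fun r => prolong ψ r j) q := fun j q hq =>
    (contDiffOn_prolong hU hψ j).differentiableAt_of_isOpen hU (by norm_num) hq
  have hV : ∀ j, ∀ q ∈ U, DifferentiableAt ℝ (fun r => obstructionV A r j) q := fun j q hq =>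
    (contDiffOn_obstructionV hU hA j).differentiableAt_of_isOpen hU (by norm_num) hq
  have hDV : ∀ a j, ∀ q ∈ U, DifferentiableAt ℝ (fun r => covD A a (obstructionV A) r j) q :=
    fun a j q hq => (contDiffOn_covD (m := 1) hU hA (contDiffOn_obstructionV hU hA)
      (by norm_num) (by norm_num) a j).differentiableAt_of_isOpen hU (by norm_num) hq
  have h0 : ∀ q ∈ U, obstructionV A q ⬝ᵥ prolong ψ q = 0 := fun q hq =>
    h.obstructionV_dotProduct hU hA hψ hq
  have h1 : ∀ a, ∀ q ∈ U, covD A a (obstructionV A) q ⬝ᵥ prolong ψ q = 0 := fun a =>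
    covD_dotProduct_eq_zero hU a hV hΨ (hpar a) h0
  have h2 : ∀ a b, ∀ q ∈ U, covD A a (covD A b (obstructionV A)) q ⬝ᵥ prolong ψ q = 0 :=
    fun a b => covD_dotProduct_eq_zero hU a (hDV b) hΨ (hpar a) (h1 b)
  -- The kernel vector is the prolongation itself; it is nonzero because its first three entries are
  -- the `ψ i q`.
  refine Matrix.exists_mulVec_eq_zero_iff.mp ⟨prolong ψ q, ?_, ?_⟩
  · obtain ⟨i, hi⟩ := hne
    intro h0
    fin_cases i
    · exact hi (congrFun h0 0)
    · exact hi (congrFun h0 1)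
    · exact hi (congrFun h0 2)
  · funext i
    change obstructionMatrix A q i ⬝ᵥ prolong ψ q = 0
    fin_cases i
    · exact h0 q hq
    · exact h1 0 q hq
    · exact h1 1 q hq
    · exact h2 0 0 q hq
    · change ((1 / 2 : ℝ) • (covD A 0 (covD A 1 (obstructionV A)) q
        + covD A 1 (covD A 0 (obstructionV A)) q)) ⬝ᵥ prolong ψ q = 0
      rw [smul_dotProduct, add_dotProduct, h2 0 1 q hq, h2 1 0 q hq]
      simp
    · exact h2 1 1 q hq

end Obstruction

/-! ### The Liouville system of a metric -/

section Metric

variable {U : Set Plane} {g : Plane → Matrix (Fin 2) (Fin 2) ℝ} {q : Plane}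

/-- The coefficients of the projective structure of the Levi-Civita connection of `g`. -/
noncomputable def metricCoeff (g : Plane → Matrix (Fin 2) (Fin 2) ℝ) : Fin 4 → Plane → ℝ :=
  ![fun q => -christoffel g 1 0 0 q,
    fun q => christoffel g 0 0 0 q - 2 * christoffel g 1 0 1 q,
    fun q => 2 * christoffel g 0 0 1 q - christoffel g 1 1 1 q,
    fun q => christoffel g 0 1 1 q]

theorem IsMetricOn.apply_comm (hg : IsMetricOn U g) (hq : q ∈ U) : g q 1 0 = g q 0 1 :=
  (hg.symm q hq).apply 0 1

theorem IsMetricOn.pd_apply_comm (hg : IsMetricOn U g) (hU : IsOpen U) (hq : q ∈ U) (a : Fin 2) :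
    pd a (fun r => g r 1 0) q = pd a (fun r => g r 0 1) q :=
  pd_congr hU hq (fun _ hr => hg.apply_comm hr) a

theorem christoffel_symm (hg : IsMetricOn U g) (hU : IsOpen U) (hq : q ∈ U) (c : Fin 2) :
    christoffel g c 1 0 q = christoffel g c 0 1 q := by
  simp only [christoffel, Fin.sum_univ_two, hg.pd_apply_comm hU hq]
  ring

/-- Lowering the index cancels the inverse metric and leaves the Christoffel symbols of the first
kind. -/
theorem IsMetricOn.sum_mul_christoffel (hg : IsMetricOn U g) (hq : q ∈ U) (a b e : Fin 2) :
    ∑ c, g q e c * christoffel g c a b q = (1 / 2) *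
      (pd b (fun r => g r a e) q + pd a (fun r => g r b e) q - pd e (fun r => g r a b) q) := by
  have h : (g q) * (g q)⁻¹ = 1 := Matrix.mul_nonsing_inv _ (hg.nondegenerate q hq).isUnit
  have h' : ∀ e d, ∑ c, g q e c * (g q)⁻¹ c d = (1 : Matrix (Fin 2) (Fin 2) ℝ) e d :=
    fun e d => by rw [← h, Matrix.mul_apply]
  calc ∑ c, g q e c * christoffel g c a b q
      = (1 / 2) * ∑ d, (∑ c, g q e c * (g q)⁻¹ c d) *
        (pd b (fun r => g r a d) q + pd a (fun r => g r b d) q - pd d (fun r => g r a b) q) := by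
        simp only [christoffel, Fin.sum_univ_two]
        ring
    _ = _ := by simp [h', Matrix.one_apply]

/-- The Levi-Civita connection is metric. -/
theorem IsMetricOn.pd_apply (hg : IsMetricOn U g) (hU : IsOpen U) (hq : q ∈ U) (a b c : Fin 2) :
    pd c (fun r => g r a b) q =
      ∑ d, (g q b d * christoffel g d a c q + g q a d * christoffel g d b c q) := by
  have hs : ∀ a b c, pd c (fun r => g r a b) q = pd c (fun r => g r b a) q := fun a b c =>
    pd_congr hU hq (fun r hr => (hg.symm r hr).apply b a) c
  -- In the sum of the two first-kind symbols all terms cancel except two halves of `∂_c g_ab`.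
  rw [Finset.sum_add_distrib, hg.sum_mul_christoffel hq, hg.sum_mul_christoffel hq,
    hs c b a, hs c a b, hs b a c]
  ring

theorem IsMetricOn.contDiffOn_det (hg : IsMetricOn U g) :
    ContDiffOn ℝ 6 (fun q => (g q).det) U := by
  simp only [Matrix.det_fin_two]
  have := hg.contDiffOn
  fun_prop

theorem IsMetricOn.contDiffOn_inv (hg : IsMetricOn U g) (c d : Fin 2) :
    ContDiffOn ℝ 6 (fun q => (g q)⁻¹ c d) U := by
  have hd : ContDiffOn ℝ 6 (fun q => ((g q).det)⁻¹) U := hg.contDiffOn_det.inv hg.nondegenerate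
  have h := hg.contDiffOn
  simp only [Matrix.inv_def, Ring.inverse_eq_inv', Matrix.adjugate_fin_two, Matrix.smul_apply,
    smul_eq_mul]
  refine hd.mul ?_
  fin_cases c <;> fin_cases d
  · exact h 1 1
  · exact (h 0 1).neg
  · exact (h 1 0).neg
  · exact h 0 0

theorem IsMetricOn.contDiffOn_christoffel (hg : IsMetricOn U g) (hU : IsOpen U) (c a b : Fin 2) :
    ContDiffOn ℝ 5 (christoffel g c a b) U := by
  have h : ∀ a b c, ContDiffOn ℝ 5 (pd c (fun r => g r a b)) U := fun a b c =>
    (hg.contDiffOn a b).pd hU (by norm_num) c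
  have hi : ∀ c d, ContDiffOn ℝ 5 (fun q => (g q)⁻¹ c d) U := fun c d =>
    (hg.contDiffOn_inv c d).of_le (by norm_num)
  refine contDiffOn_const.mul (ContDiffOn.sum fun d _ => (hi c d).mul ?_)
  exact ((h a d b).add (h b d a)).sub (h a b d)

theorem IsMetricOn.contDiffOn_metricCoeff (hg : IsMetricOn U g) (hU : IsOpen U) (i : Fin 4) :
    ContDiffOn ℝ 5 (metricCoeff g i) U := by
  have h := hg.contDiffOn_christoffel hU
  fin_cases i
  · exact (h 1 0 0).neg
  · exact (h 0 0 0).sub (contDiffOn_const.mul (h 1 0 1))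
  · exact (contDiffOn_const.mul (h 0 0 1)).sub (h 1 1 1)
  · exact h 0 1 1

/-- The weight `|Δ|^(-2/3)` of a metric with determinant `Δ`. -/
noncomputable def metricWeight (g : Plane → Matrix (Fin 2) (Fin 2) ℝ) : Plane → ℝ := fun q =>
  ((g q).det ^ 2) ^ (-(1 / 3) : ℝ)

theorem IsMetricOn.contDiffOn_metricWeight (hg : IsMetricOn U g) :
    ContDiffOn ℝ 6 (metricWeight g) U :=
  -- Squaring the determinant makes the base of the real power positive in either signature.
  (hg.contDiffOn_det.pow 2).rpow_const_of_ne fun q hq => pow_ne_zero 2 (hg.nondegenerate q hq)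

theorem IsMetricOn.pd_metricWeight (hg : IsMetricOn U g) (hU : IsOpen U) (hq : q ∈ U)
    (a : Fin 2) : pd a (metricWeight g) q =
      -(4/3) * (christoffel g 0 0 a q + christoffel g 1 1 a q) * metricWeight g q := by
  have hne := hg.nondegenerate q hq
  have hd : DifferentiableAt ℝ (fun q => (g q).det) q :=
    hg.contDiffOn_det.differentiableAt_of_isOpen hU (by norm_num) hq
  have dg : ∀ a b, DifferentiableAt ℝ (fun q => g q a b) q := fun a b =>
    (hg.contDiffOn a b).differentiableAt_of_isOpen hU (by norm_num) hq
  have hφ : HasDerivAt (fun t : ℝ => (t ^ 2) ^ (-(1 / 3) : ℝ))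
      (-(2/3) * ((g q).det ^ 2) ^ (-(1 / 3) : ℝ) / (g q).det) (g q).det := by
    have h := (hasDerivAt_pow 2 (g q).det).rpow_const (p := (-(1 / 3) : ℝ))
      (Or.inl (pow_ne_zero 2 hne))
    convert h using 1
    rw [Real.rpow_sub_one (pow_ne_zero 2 hne)]
    field_simp
    norm_num
  -- Jacobi's formula, `∂ₐΔ = 2 Δ Γᶜ_ca`.
  have hdet : pd a (fun q => (g q).det) q
      = 2 * (g q).det * (christoffel g 0 0 a q + christoffel g 1 1 a q) := by
    simp only [Matrix.det_fin_two]
    rw [pd_sub ((dg 0 0).fun_mul (dg 1 1)) ((dg 0 1).fun_mul (dg 1 0)), pd_mul (dg 0 0) (dg 1 1),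
      pd_mul (dg 0 1) (dg 1 0)]
    simp only [hg.pd_apply hU hq, Fin.sum_univ_two, hg.apply_comm hq]
    ring
  have h := pd_comp (a := a) hφ hd
  change pd a (metricWeight g) q = _ at h
  rw [h, hdet]
  simp only [metricWeight]
  field_simp
  ring

/-- The weighted components `(E, F, G) / |Δ|^(2/3)` of a metric. -/
noncomputable def weightedMetric (g : Plane → Matrix (Fin 2) (Fin 2) ℝ) : Fin 3 → Plane → ℝ :=
  ![fun q => metricWeight g q * g q 0 0, fun q => metricWeight g q * g q 0 1,
    fun q => metricWeight g q * g q 1 1]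

theorem IsMetricOn.contDiffOn_weightedMetric (hg : IsMetricOn U g) (i : Fin 3) :
    ContDiffOn ℝ 6 (weightedMetric g i) U := by
  fin_cases i
  · exact hg.contDiffOn_metricWeight.mul (hg.contDiffOn 0 0)
  · exact hg.contDiffOn_metricWeight.mul (hg.contDiffOn 0 1)
  · exact hg.contDiffOn_metricWeight.mul (hg.contDiffOn 1 1)

theorem IsMetricOn.exists_weightedMetric_ne_zero (hg : IsMetricOn U g) (hq : q ∈ U) :
    ∃ i, weightedMetric g i q ≠ 0 := by
  have hne := hg.nondegenerate q hq
  have hw : metricWeight g q ≠ 0 := (Real.rpow_pos_of_pos (by positivity) _).ne'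
  by_contra! h
  have h0 : g q 0 0 = 0 := (mul_eq_zero.mp (h 0)).resolve_left hw
  have h1 : g q 0 1 = 0 := (mul_eq_zero.mp (h 1)).resolve_left hw
  -- The first row of `g` alone being zero already kills the determinant.
  exact hne (by simp [Matrix.det_fin_two, h0, h1])

/-- The four equations are the components of the symmetrised derivative of the weighted metric. With
the exponent `-2/3`, the trace terms from the weight combine with those from metricity so that only
the projective coefficients remain: in `∂ₓψ₀`, for example, `2Γ⁰₀₀ - 4/3 (Γ⁰₀₀ + Γ¹₀₁) = 2/3 (Γ⁰₀₀ -
2Γ¹₀₁)`. -/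
theorem IsMetricOn.isLiouvilleSolution (hg : IsMetricOn U g) (hU : IsOpen U) :
    IsLiouvilleSolution U (metricCoeff g) (weightedMetric g) := by
  have key : ∀ q ∈ U, ∀ a b c, pd c (fun r => metricWeight g r * g r a b) q
      = metricWeight g q * (g q b 0 * christoffel g 0 a c q + g q a 0 * christoffel g 0 b c q
        + (g q b 1 * christoffel g 1 a c q + g q a 1 * christoffel g 1 b c q)
        - 4/3 * (christoffel g 0 0 c q + christoffel g 1 1 c q) * g q a b) := by
    intro q hq a b c
    rw [pd_mul (hg.contDiffOn_metricWeight.differentiableAt_of_isOpen hU (by norm_num) hq)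
      ((hg.contDiffOn a b).differentiableAt_of_isOpen hU (by norm_num) hq),
      hg.pd_metricWeight hU hq, hg.pd_apply hU hq, Fin.sum_univ_two]
    ring
  constructor <;> intro q hq <;>
    simp only [weightedMetric, metricCoeff, Matrix.cons_val, key q hq, hg.apply_comm hq,
      christoffel_symm hg hU hq] <;> ring

end Metric

/-! ### Integral curves with given initial data -/

section IntegralCurves

open Set Filter Topology

variable {U : Set Plane} {Λ : Plane → ℝ → ℝ} {q : Plane}

theorem vec_eta (q : Plane) : ![q 0, q 1] = q := by
  funext i
  fin_cases i <;> rfl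

/-- Picard–Lindelöf for the autonomous first order system `(x, y, p)' = (1, p, Λ(x, y, p))`. -/
theorem exists_isIntegralCurveOf (hU : IsOpen U)
    (hΛ : ContDiffOn ℝ 1 (fun z : Plane × ℝ => Λ z.1 z.2) (U ×ˢ univ)) (hq : q ∈ U) (p : ℝ) :
    ∃ ε > 0, ∃ y : ℝ → ℝ, IsIntegralCurveOf U Λ (Ioo (q 0 - ε) (q 0 + ε)) y ∧
      y (q 0) = q 1 ∧ deriv y (q 0) = p := by
  let v : ℝ × ℝ × ℝ → ℝ × ℝ × ℝ := fun z => (1, z.2.2, Λ ![z.1, z.2.1] z.2.2)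
  have hv : ContDiffAt ℝ 1 v (q 0, q 1, p) := by
    have hm : ContDiff ℝ 1 fun z : ℝ × ℝ × ℝ => ((![z.1, z.2.1] : Plane), z.2.2) := by
      refine ContDiff.prodMk (contDiff_pi.mpr fun i => ?_) (by fun_prop)
      fin_cases i
      · exact contDiff_fst
      · exact contDiff_fst.comp contDiff_snd
    have hΛ' : ContDiffAt ℝ 1 (fun z : Plane × ℝ => Λ z.1 z.2) (![q 0, q 1], p) :=
      hΛ.contDiffAt ((hU.prod isOpen_univ).mem_nhds ⟨by rwa [vec_eta], mem_univ _⟩)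
    exact contDiffAt_const.prodMk ((contDiff_snd.comp contDiff_snd).contDiffAt.prodMk
      (hΛ'.comp (f := fun z : ℝ × ℝ × ℝ => ((![z.1, z.2.1] : Plane), z.2.2)) (q 0, q 1, p)
        hm.contDiffAt))
  obtain ⟨α, hα0, ε, hε, hα⟩ :=
    hv.exists_forall_mem_closedBall_exists_eq_forall_mem_Ioo_hasDerivAt₀ (q 0)
  have hx' : ∀ t ∈ Ioo (q 0 - ε) (q 0 + ε), HasDerivAt (fun t => (α t).1) 1 t := fun t ht =>
    (hα t ht).fst
  have hy' : ∀ t ∈ Ioo (q 0 - ε) (q 0 + ε),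
      HasDerivAt (fun t => (α t).2.1) (α t).2.2 t := fun t ht => (hα t ht).snd.fst
  have hp' : ∀ t ∈ Ioo (q 0 - ε) (q 0 + ε), HasDerivAt (fun t => (α t).2.2)
      (Λ ![(α t).1, (α t).2.1] (α t).2.2) t := fun t ht => (hα t ht).snd.snd
  have h0 : q 0 ∈ Ioo (q 0 - ε) (q 0 + ε) := by constructor <;> linarith
  -- The first coordinate has derivative 1 and starts at `q 0`, so the parameter of the flow is `x`
  -- itself.
  have hx : ∀ t ∈ Ioo (q 0 - ε) (q 0 + ε), (α t).1 = t := by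
    refine isOpen_Ioo.eqOn_of_deriv_eq (f := fun t => (α t).1) (g := id) isPreconnected_Ioo
      (fun t ht => (hx' t ht).differentiableAt.differentiableWithinAt) differentiableOn_id
      (fun t ht => by rw [(hx' t ht).deriv, deriv_id]) h0 (by simp [hα0])
  have hdy : ∀ t ∈ Ioo (q 0 - ε) (q 0 + ε), deriv (fun t => (α t).2.1) t = (α t).2.2 :=
    fun t ht => (hy' t ht).deriv
  have hc : ContinuousAt (fun t => (![t, (α t).2.1] : Plane)) (q 0) := by
    refine continuousAt_pi.mpr fun i => ?_
    fin_cases i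
    · exact continuousAt_id
    · exact (hy' _ h0).continuousAt
  -- The solution may leave `U` within the first interval; continuity gives a smaller one on which
  -- its graph stays inside.
  have hmem : ∀ᶠ t in 𝓝 (q 0), (![t, (α t).2.1] : Plane) ∈ U := by
    refine hc.eventually_mem (hU.mem_nhds ?_)
    simpa only [hα0, vec_eta] using hq
  obtain ⟨δ, hδ, hδU⟩ := Metric.eventually_nhds_iff_ball.mp hmem
  rw [Real.ball_eq_Ioo] at hδU
  refine ⟨min ε δ, lt_min hε hδ, fun t => (α t).2.1, fun t ht => ?_, by simp [hα0], by
    simp [hdy _ h0, hα0]⟩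
  have hte : t ∈ Ioo (q 0 - ε) (q 0 + ε) :=
    ⟨by linarith [ht.1, min_le_left ε δ], by linarith [ht.2, min_le_left ε δ]⟩
  have htd : t ∈ Ioo (q 0 - δ) (q 0 + δ) :=
    ⟨by linarith [ht.1, min_le_right ε δ], by linarith [ht.2, min_le_right ε δ]⟩
  refine ⟨hδU t htd, (hy' t hte).differentiableAt, ?_⟩
  have h := hp' t hte
  rw [hx t hte, ← hdy t hte] at h
  exact h.congr_of_eventuallyEq (eventually_of_mem (isOpen_Ioo.mem_nhds hte) hdy)

/-- The graph of a solution of `y'' = Λ(x, y, y')` is a geodesic only if `Λ` is given by the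
connection symbols. -/
theorem IsUnparametrisedGeodesicOn.eq_of_graph {Γ : Fin 2 → Fin 2 → Fin 2 → Plane → ℝ}
    {I : Set ℝ} (hI : IsOpen I) {y : ℝ → ℝ} {x p m : ℝ} (hx : x ∈ I) (hp : deriv y x = p)
    (hy : HasDerivAt (deriv y) m x)
    (h : IsUnparametrisedGeodesicOn Γ I (fun x => ![x, y x])) :
    m = p * (∑ a, ∑ b, Γ 0 a b ![x, y x] * ![1, p] a * ![1, p] b)
      - ∑ a, ∑ b, Γ 1 a b ![x, y x] * ![1, p] a * ![1, p] b := by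
  obtain ⟨v, hv⟩ := h
  have hd : ∀ t ∈ I, deriv (fun x => (![x, y x] : Plane)) t = ![1, deriv y t] := by
    intro t ht
    have h := hasDerivAt_pi.mp (hv t ht).1.hasDerivAt
    have h0 : HasDerivAt (fun x : ℝ => x) _ t := h 0
    have h1 : HasDerivAt y _ t := h 1
    rw [← vec_eta (deriv (fun x => (![x, y x] : Plane)) t), h0.unique (hasDerivAt_id t), h1.deriv]
  have h2 := (hv x hx).2.2
  simp only [hd x hx, hp] at h2
  have h3 := h2.congr_of_eventuallyEq (f₁ := fun t => (![1, deriv y t] : Plane))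
    (eventually_of_mem (hI.mem_nhds hx) fun t ht => (hd t ht).symm)
  have h4 := hasDerivAt_pi.mp h3
  -- The first component has constant velocity 1, so its geodesic equation determines `v`; the final
  -- combination substitutes this value into the second equation.
  have e0 := HasDerivAt.unique (show HasDerivAt (fun _ : ℝ => (1 : ℝ)) _ x from h4 0)
    (hasDerivAt_const x 1)
  have e1 := HasDerivAt.unique (show HasDerivAt (deriv y) _ x from h4 1) hy
  simp only [Matrix.cons_val] at e0 e1
  linear_combination p * e0 - e1

end IntegralCurves

theorem corollary1p2 (U : Set Plane) (hU : IsOpen U)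
    (Λ : Plane → ℝ → ℝ)
    (hΛ : ContDiffOn ℝ 1 (fun z : Plane × ℝ => Λ z.1 z.2) (U ×ˢ Set.univ))
    (g : Plane → Matrix (Fin 2) (Fin 2) ℝ) (hg : IsMetricOn U g)
    (hgeo : ∀ (a b : ℝ) (y : ℝ → ℝ), IsIntegralCurveOf U Λ (Set.Ioo a b) y →
      IsUnparametrisedGeodesicOn (christoffel g) (Set.Ioo a b) (fun x => ![x, y x])) :
    ∃ A : Fin 4 → Plane → ℝ,
      (∀ i, ContDiffOn ℝ 5 (A i) U) ∧
      (∀ q ∈ U, ∀ p : ℝ, Λ q p = A 3 q * p ^ 3 + A 2 q * p ^ 2 + A 1 q * p + A 0 q) ∧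
      ∀ q ∈ U, (obstructionMatrix A q).det = 0 := by
  refine ⟨metricCoeff g, hg.contDiffOn_metricCoeff hU, fun q hq p => ?_, fun q hq =>
    det_obstructionMatrix_eq_zero hU (hg.isLiouvilleSolution hU) (hg.contDiffOn_metricCoeff hU)
      hg.contDiffOn_weightedMetric hq (hg.exists_weightedMetric_ne_zero hq)⟩
  obtain ⟨ε, hε, y, hy, hy0, hy1⟩ := exists_isIntegralCurveOf hU hΛ hq p
  have hx : q 0 ∈ Set.Ioo (q 0 - ε) (q 0 + ε) := by constructor <;> linarith
  have h := (hgeo _ _ y hy).eq_of_graph isOpen_Ioo hx hy1 (hy _ hx).2.2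
  rw [hy0, hy1, vec_eta] at h
  rw [h]
  -- Collecting powers of `p`, with `Γ` symmetric in its lower indices, gives exactly the
  -- coefficients `metricCoeff g`.
  simp only [metricCoeff, Fin.sum_univ_two, Matrix.cons_val, christoffel_symm hg hU hq]
  ring
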